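/- All graphs are finite and simple, $H\le G$ means that $H$ is an induced subgraph of $G$ (up to isomorphism), $d(G)$ is the diameter of $G$, and $n(G)$ is the number of negative eigenvalues, with multiplicity, of the adjacency matrix of $G$. A graph is reduced if no two distinct vertices have the same neighborhood. For integers $k\ge 1$ and $0\le t\le k$ let $G_1(k,t)$ be the following graph. Its vertices are $v_1,\dots,v_{2k+2}$; the vertices $a_i$ for $i\in\{4,6,\dots,2t+2\}\cup\{2t+1,2t+3,\dots,2k-1\}$; and the vertices $c_i$ for those $i\in\{2t,2t+2\}$ with $2\le i\le 2k$. Its edges are $v_iv_{i+1}$ $(1\le i\le 2k+1)$, $a_iv_i$, $c_iv_i$ and $c_iv_{i+1}$ (for all existing $a_i$, $c_i$), and $a_{2t+1}a_{2t+2}$, $a_{2t+1}c_{2t+2}$, $a_{2t+2}c_{2t}$, $c_{2t}c_{2t+2}$ (each if both its ends exist). Let $P$ denote the path $v_1v_2\cdots v_{2k+2}$ of order $2k+2$ in $G_1(k,t)$. **Theorem.** Let $G$ be a reduced connected graph and $k\ge 1$ an integer. Then $d(G)=2k+1$ and $n(G)=k+1$ if and only if, for some $t\in\{0,1,\dots,k\}$,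 up to isomorphism $P\le G\le G_1(k,t)$ (that is, $G$ is an induced subgraph of $G_1(k,t)$ containing all of $v_1,\dots,v_{2k+2}$), where in the two end cases moreover $a_1\in V(G)$ implies $c_2\in V(G)$, and $a_{2k+2}\in V(G)$ implies $c_{2k}\in V(G)$. (These last two conditions are void for $1\le t\le k-1$, since $a_1$ exists only for $t=0$ and $a_{2k+2}$ only for $t=k$.) -/

import Mathlib

namespace NegInertiaDiam

/-- The negative inertia index `n(G)`: the number of negative eigenvalues, counted with
multiplicity, of the adjacency matrix of a finite graph. -/
noncomputable def negInertia {V : Type*} [Fintype V] [DecidableEq V] (G : SimpleGraph V)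
    [DecidableRel G.Adj] : ℕ :=
  (Finset.univ.filter fun i : V => (G.isHermitian_adjMatrix ℝ).eigenvalues i < 0).card

/-- A graph is reduced if it has no twins: distinct vertices have distinct neighborhoods. -/
def IsReduced {V : Type*} (G : SimpleGraph V) : Prop :=
  ∀ u v : V, G.neighborSet u = G.neighborSet v → u = v

/-- The vertices of the graph `G₁(k, t)`:
* `spine i` is the vertex `v_i` of the path `v_1 v_2 … v_{2k+2}`;
* `single i` is the vertex `a_i` outside the path whose only neighbor on the path is `v_i`; the
  indices are `i = 4, 6, …, 2t+2` and `i = 2t+1, 2t+3, …, 2k-1`;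
* `double i` is the vertex `c_i` outside the path whose neighbors on the path are `v_i` and
  `v_{i+1}`; the indices are `i = 2t` (if `t ≥ 1`) and `i = 2t+2` (if `t < k`). -/
inductive G1Vertex (k t : ℕ) : Type
  | spine (i : ℕ) (h : 1 ≤ i ∧ i ≤ 2 * k + 2)
  | single (i : ℕ)
      (h : (Even i ∧ 4 ≤ i ∧ i ≤ 2 * t + 2) ∨ (Odd i ∧ 2 * t + 1 ≤ i ∧ i + 1 ≤ 2 * k))
  | double (i : ℕ) (h : (i = 2 * t ∨ i = 2 * t + 2) ∧ 2 ≤ i ∧ i ≤ 2 * k)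

/-- The edges of `G₁(k, t)`, each listed in one direction. Besides the edges of the path and the
edges between the path and the other vertices, they are `a_{2t+1} a_{2t+2}`, `a_{2t+1} c_{2t+2}`,
`a_{2t+2} c_{2t}` and `c_{2t} c_{2t+2}` (as far as these vertices exist). -/
def G1Edge (k t : ℕ) : G1Vertex k t → G1Vertex k t → Prop
  | .spine i _, .spine j _ => j = i + 1
  | .spine i _, .single j _ => i = j
  | .spine i _, .double j _ => i = j ∨ i = j + 1
  | .single i _, .single j _ => i = 2 * t + 1 ∧ j = 2 * t + 2
  | .single i _, .double j _ =>
      (i = 2 * t + 1 ∧ j = 2 * t + 2) ∨ (i = 2 * t + 2 ∧ j = 2 * t)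
  | .double i _, .double j _ => i = 2 * t ∧ j = 2 * t + 2
  | _, _ => False

/-- The graph `G₁(k, t)` for `0 ≤ t ≤ k`. For `1 ≤ t ≤ k - 1` the six vertices
`v_{2t+1}, a_{2t+2}, c_{2t+2}` and `v_{2t+2}, a_{2t+1}, c_{2t}` are the two sides of a `K_{3,3}`,
and removing `k` times a pendant vertex together with its neighbor leaves this `K_{3,3}`. -/
def G1 (k t : ℕ) : SimpleGraph (G1Vertex k t) :=
  SimpleGraph.fromRel (G1Edge k t)

/-- The path `v_1 v_2 … v_{2k+2}` of `G₁(k, t)`, as a map from the vertices `0, 1, …, 2k+1` of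
the path graph. -/
def spineVertex (k t : ℕ) (i : Fin (2 * k + 2)) : G1Vertex k t :=
  .spine (i.val + 1) ⟨by omega, by omega⟩

end NegInertiaDiam

/-!
The vertices of a path on `2k + 2` vertices are numbered `1, …, 2k + 2`. Its adjacency matrix `B`
is invertible with `k + 1` negative eigenvalues, and its inverse `R` is explicit (`pathInv`): the
entry at positions `i < j` is `(-1) ^ ((j - i - 1) / 2)` if `i` is odd and `j` even, and zero
otherwise.

Let the path be an induced path of `G`, let `A` be the adjacency matrix of `G` and let `C` consist
of the columns of `A` that belong to the path. By the inertia of Schur complements, `n(G) = k + 1`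
if and only if the Schur complement `A - C R Cᵀ` is positive semidefinite. If the path is a
geodesic, the neighbors of a vertex on it lie within three consecutive positions, and the diagonal
of the Schur complement turns out to be nonpositive (`attachMatrix_form_nonneg`). A positive
semidefinite matrix with nonpositive diagonal is zero, so the condition becomes the identity
`A = C R Cᵀ` (`adjMatrix_factorization`, `negInertia_le_of_factorization`): two vertices are
adjacent precisely when the form of `R` takes the value `1` on their neighborhoods on the path, and
otherwise it takes the value `0`.

The graph `G₁(k, t)` satisfies this identity (`G1_adj_eq_form`), which gives the inertia of every
graph between the path and `G₁(k, t)`; its diameter is found by estimating distances. Conversely,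
in a reduced connected graph satisfying the identity, a vertex is determined by its neighborhood on
the path. The vanishing diagonal leaves single positions `i` and pairs `i, i + 1` with `i` even
(`attachMatrix_classification`). The off-diagonal entries must be `0` or `1` and compatible with
the path being a geodesic, which forces every even position `e` and every odd position `o` of
vertices off the path to satisfy `e ≤ o + 1` (`OffPath.le_succ`). Hence some `t` satisfies
`e ≤ 2t + 2` and `2t + 1 ≤ o` throughout, and this says that all vertices occur in `G₁(k, t)`. The
conditions at the two ends express that no vertex is at distance `2k + 2` from an end of the path.
-/

namespace NegInertiaDiam

open Matrix Finset

/-! ### Negative eigenvalues and subspaces -/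

section Inertia

variable {V : Type*} [Fintype V] [DecidableEq V]

theorem dotProduct_mulVec_eq_sum_eigenvalues {A : Matrix V V ℝ} (hA : A.IsHermitian) (z : V → ℝ) :
    z ⬝ᵥ A *ᵥ z =
      ∑ i, hA.eigenvalues i * ((hA.eigenvectorUnitary : Matrix V V ℝ)ᵀ *ᵥ z) i ^ 2 := by
  set U : Matrix V V ℝ := (hA.eigenvectorUnitary : Matrix V V ℝ) with hU
  have h : A = U * diagonal hA.eigenvalues * Uᵀ := by
    have := hA.spectral_theorem
    rw [Unitary.conjStarAlgAut_apply] at this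
    conv_lhs => rw [this]
    rfl
  conv_lhs => rw [h]
  rw [← mulVec_mulVec, ← mulVec_mulVec, dotProduct_mulVec, ← mulVec_transpose]
  simp only [dotProduct, mulVec_diagonal]
  exact Finset.sum_congr rfl fun i _ => by ring

/-- A linear map into a space on whose image the form of `A` is negative definite bounds the number
of negative eigenvalues from below: the coordinates along the negative eigenvectors are already
injective on the image. -/
theorem finrank_le_card_neg_eigenvalues {A : Matrix V V ℝ} (hA : A.IsHermitian)
    {M : Type*} [AddCommGroup M] [Module ℝ M] [FiniteDimensional ℝ M] (L : M →ₗ[ℝ] V → ℝ)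
    (hL : ∀ z, z ≠ 0 → L z ⬝ᵥ A *ᵥ L z < 0) :
    Module.finrank ℝ M ≤ (univ.filter fun i => hA.eigenvalues i < 0).card := by
  let U : Matrix V V ℝ := (hA.eigenvectorUnitary : Matrix V V ℝ)
  let T : M →ₗ[ℝ] ({i // hA.eigenvalues i < 0} → ℝ) :=
    (LinearMap.funLeft ℝ ℝ Subtype.val) ∘ₗ (Uᵀ).mulVecLin ∘ₗ L
  have hT : Function.Injective T := by
    rw [injective_iff_map_eq_zero]
    intro z hz
    by_contra hne
    refine absurd (hL z hne) (not_lt.2 ?_)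
    rw [dotProduct_mulVec_eq_sum_eigenvalues hA]
    refine Finset.sum_nonneg fun i _ => ?_
    by_cases hi : hA.eigenvalues i < 0
    · have : (Uᵀ *ᵥ L z) i = 0 := congrFun hz ⟨i, hi⟩
      change 0 ≤ _ * (Uᵀ *ᵥ L z) i ^ 2
      simp [this]
    · exact mul_nonneg (not_lt.1 hi) (sq_nonneg _)
  have := LinearMap.finrank_le_finrank_of_injective hT
  rwa [Module.finrank_fintype_fun_eq_card, Fintype.card_subtype] at this

/-- If the form of `A` is nonnegative on the kernel of `T`, then `T` is injective on the span of
the negative eigenvectors, so their number is at most the dimension of the target of `T`. -/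
theorem card_neg_eigenvalues_le_finrank {A : Matrix V V ℝ} (hA : A.IsHermitian)
    {M : Type*} [AddCommGroup M] [Module ℝ M] [FiniteDimensional ℝ M] (T : (V → ℝ) →ₗ[ℝ] M)
    (hT : ∀ z, T z = 0 → 0 ≤ z ⬝ᵥ A *ᵥ z) :
    (univ.filter fun i => hA.eigenvalues i < 0).card ≤ Module.finrank ℝ M := by
  let U : Matrix V V ℝ := (hA.eigenvectorUnitary : Matrix V V ℝ)
  have hUU : Uᵀ * U = 1 := Unitary.coe_star_mul_self hA.eigenvectorUnitary
  let E : ({i // hA.eigenvalues i < 0} → ℝ) →ₗ[ℝ] (V → ℝ) :=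
    Function.ExtendByZero.linearMap ℝ Subtype.val
  have hE : ∀ y i, E y i.1 = y i := fun y i => Subtype.val_injective.extend_apply _ _ _
  have hE' : ∀ y i, ¬ hA.eigenvalues i < 0 → E y i = 0 := fun y i hi =>
    Function.extend_apply' _ _ _ (by rintro ⟨a, rfl⟩; exact hi a.2)
  let S : ({i // hA.eigenvalues i < 0} → ℝ) →ₗ[ℝ] M := T ∘ₗ U.mulVecLin ∘ₗ E
  have hS : Function.Injective S := by
    rw [injective_iff_map_eq_zero]
    intro y hy
    have h := hT (U *ᵥ E y) hy
    rw [dotProduct_mulVec_eq_sum_eigenvalues hA] at h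
    change 0 ≤ ∑ i, hA.eigenvalues i * (Uᵀ *ᵥ U *ᵥ E y) i ^ 2 at h
    rw [mulVec_mulVec, hUU, one_mulVec] at h
    have hle : ∀ i ∈ univ, hA.eigenvalues i * E y i ^ 2 ≤ 0 := fun i _ => by
      by_cases hi : hA.eigenvalues i < 0
      · exact mul_nonpos_of_nonpos_of_nonneg hi.le (sq_nonneg _)
      · simp [hE' y i hi]
    have hz := (Finset.sum_eq_zero_iff_of_nonpos hle).1 (le_antisymm (Finset.sum_nonpos hle) h)
    ext i
    have := hz i.1 (mem_univ _)
    rw [hE] at this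
    simpa [i.2.ne] using this
  have := LinearMap.finrank_le_finrank_of_injective hS
  rwa [Module.finrank_fintype_fun_eq_card, Fintype.card_subtype] at this

end Inertia

/-! ### The adjacency matrix of a path and its inverse -/

section PathMatrix

/-- The entries of the inverse of the adjacency matrix of a path on an even number of vertices,
with vertices numbered from `1`. The formula does not mention the length of the path, and makes
sense at the positions `0` and `n + 1` just outside it as well. -/
noncomputable def pathInv (i j : ℕ) : ℝ :=
  if Odd i ∧ Even j ∧ i < j then (-1) ^ ((j - i - 1) / 2)
  else if Even i ∧ Odd j ∧ j < i then (-1) ^ ((i - j - 1) / 2) else 0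

theorem pathInv_of_lt {i j : ℕ} (hi : Odd i) (hj : Even j) (h : i < j) :
    pathInv i j = (-1) ^ ((j - i - 1) / 2) := if_pos ⟨hi, hj, h⟩

theorem pathInv_comm (i j : ℕ) : pathInv i j = pathInv j i := by
  unfold pathInv
  grind

theorem pathInv_eq_zero {i j : ℕ} (h : (Odd i → Even j → j < i) ∧ (Even i → Odd j → i < j)) :
    pathInv i j = 0 := by
  unfold pathInv
  grind

theorem pathInv_succ {i : ℕ} (hi : Odd i) : pathInv i (i + 1) = 1 := by
  rw [pathInv_of_lt hi hi.add_one (by omega)]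
  simp

theorem pathInv_add_three {i : ℕ} (hi : Odd i) : pathInv i (i + 3) = -1 := by
  rw [pathInv_of_lt hi (by grind) (by omega)]
  simp

/-- The three-term recurrence that makes `pathInv` the inverse of the path matrix. -/
theorem pathInv_add_pathInv (j i : ℕ) (hi : 1 ≤ i) :
    pathInv j (i - 1) + pathInv j (i + 1) = if j = i then 1 else 0 := by
  obtain ⟨i, rfl⟩ : ∃ m, i = m + 1 := ⟨i - 1, by omega⟩
  rcases Nat.even_or_odd j with hj | hj <;> rcases Nat.even_or_odd i with he | ho
  · rw [pathInv_eq_zero, pathInv_eq_zero, if_neg] <;> grind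
  · rcases lt_trichotomy j (i + 1) with h | rfl | h
    · rw [pathInv_eq_zero, pathInv_eq_zero, if_neg] <;> grind
    · rw [pathInv_comm, Nat.add_sub_cancel, pathInv_succ ho, pathInv_eq_zero, if_pos rfl] <;> grind
    · rw [pathInv_comm, Nat.add_sub_cancel, pathInv_of_lt ho hj (by omega), pathInv_comm,
        pathInv_of_lt (by grind) hj (by grind), if_neg (by omega)]
      rw [show (j - i - 1) / 2 = (j - (i + 1 + 1) - 1) / 2 + 1 by grind, pow_succ]
      ring
  · rcases lt_trichotomy j (i + 1) with h | rfl | h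
    · rw [Nat.add_sub_cancel, pathInv_of_lt hj he (by grind),
        pathInv_of_lt hj (by grind) (by grind), if_neg (by omega)]
      rw [show (i + 1 + 1 - j - 1) / 2 = (i - j - 1) / 2 + 1 by grind, pow_succ]
      ring
    · rw [pathInv_eq_zero, pathInv_succ hj, if_pos rfl] <;> grind
    · rw [pathInv_eq_zero, pathInv_eq_zero, if_neg] <;> grind
  · rw [pathInv_eq_zero, pathInv_eq_zero, if_neg] <;> grind

/-- The basis vector of position `i`, where positions run from `1` to `n`. It is the zero vector
when `i` is outside this range, so that the boundary cases of the path need no separate formulas.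
-/
def posVec (n i : ℕ) : Fin n → ℝ := fun a => if (a : ℕ) + 1 = i then 1 else 0

theorem posVec_apply (n i : ℕ) (a : Fin n) : posVec n i a = if (a : ℕ) + 1 = i then 1 else 0 := rfl

theorem posVec_eq_single {n : ℕ} (a : Fin n) : posVec n (a + 1) = Pi.single a 1 := by
  ext b
  simp [posVec_apply, Pi.single_apply, Fin.ext_iff]

theorem posVec_eq_zero {n i : ℕ} (h : i = 0 ∨ n < i) : posVec n i = 0 := by
  ext a
  rw [posVec_apply, if_neg (by omega)]
  rfl

/-- The adjacency matrix of the path on `n` vertices. -/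
noncomputable def pathMatrix (n : ℕ) : Matrix (Fin n) (Fin n) ℝ :=
  of fun i j => if (i : ℕ) + 1 = j ∨ (j : ℕ) + 1 = i then 1 else 0

/-- The inverse of `pathMatrix n` for even `n`, see `pathInvMatrix_mul_pathMatrix`. -/
noncomputable def pathInvMatrix (n : ℕ) : Matrix (Fin n) (Fin n) ℝ :=
  of fun i j => pathInv (i + 1) (j + 1)

theorem pathInvMatrix_transpose (n : ℕ) : (pathInvMatrix n)ᵀ = pathInvMatrix n := by
  ext i j
  exact pathInv_comm _ _

theorem pathMatrix_transpose (n : ℕ) : (pathMatrix n)ᵀ = pathMatrix n := by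
  ext i j
  simp [pathMatrix, or_comm]

theorem pathInvMatrix_mulVec_posVec {n : ℕ} (hn : Even n) {j : ℕ} (hj : j ≤ n + 1) (i : Fin n) :
    (pathInvMatrix n *ᵥ posVec n j) i = pathInv (i + 1) j := by
  -- At the boundary positions `0` and `n + 1` both sides vanish.
  rcases Nat.eq_zero_or_pos j with rfl | h0
  · rw [posVec_eq_zero (Or.inl rfl), mulVec_zero, pathInv_eq_zero (by grind)]
    rfl
  rcases hj.eq_or_lt with rfl | h1
  · rw [posVec_eq_zero (Or.inr (Nat.lt_succ_self n)), mulVec_zero, pathInv_eq_zero (by grind)]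
    rfl
  obtain ⟨a, rfl⟩ : ∃ a : Fin n, j = a + 1 := ⟨⟨j - 1, by omega⟩, by simp; omega⟩
  rw [posVec_eq_single, mulVec_single_one]
  rfl

/-- The bilinear form of the inverse path matrix on basis vectors. It also holds at the positions
`0` and `n + 1`, where both sides vanish; this uses that `n` is even. -/
theorem posVec_dotProduct_posVec {n : ℕ} (hn : Even n) {i j : ℕ} (hi : i ≤ n + 1)
    (hj : j ≤ n + 1) : posVec n i ⬝ᵥ pathInvMatrix n *ᵥ posVec n j = pathInv i j := by
  rcases Nat.eq_zero_or_pos i with rfl | h0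
  · rw [posVec_eq_zero (Or.inl rfl), zero_dotProduct, pathInv_eq_zero (by grind)]
  rcases hi.eq_or_lt with rfl | h1
  · rw [posVec_eq_zero (Or.inr (Nat.lt_succ_self n)), zero_dotProduct, pathInv_eq_zero (by grind)]
  obtain ⟨a, rfl⟩ : ∃ a : Fin n, i = a + 1 := ⟨⟨i - 1, by omega⟩, by simp; omega⟩
  rw [posVec_eq_single, single_one_dotProduct, pathInvMatrix_mulVec_posVec hn hj]

theorem pathMatrix_col {n : ℕ} (a : Fin n) :
    (pathMatrix n).col a = posVec n a + posVec n (a + 2) := by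
  ext b
  simp only [pathMatrix, col_apply, of_apply, Pi.add_apply, posVec_apply]
  grind

theorem pathInvMatrix_mul_pathMatrix {n : ℕ} (hn : Even n) :
    pathInvMatrix n * pathMatrix n = 1 := by
  ext i j
  have h : (pathInvMatrix n * pathMatrix n) i j
      = (pathInvMatrix n *ᵥ (pathMatrix n).col j) i := rfl
  rw [h, pathMatrix_col, mulVec_add, Pi.add_apply, pathInvMatrix_mulVec_posVec hn (by omega),
    pathInvMatrix_mulVec_posVec hn (by omega)]
  have := pathInv_add_pathInv (i + 1) (j + 1) (by omega)
  rw [Nat.add_sub_cancel] at this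
  rw [this, one_apply]
  simp [Fin.ext_iff]

theorem pathMatrix_mul_pathInvMatrix {n : ℕ} (hn : Even n) :
    pathMatrix n * pathInvMatrix n = 1 :=
  mul_eq_one_comm.1 (pathInvMatrix_mul_pathMatrix hn)

theorem dotProduct_pathMatrix_mulVec (m : ℕ) (x : ℕ → ℝ) :
    (fun i : Fin (m + 1) => x i) ⬝ᵥ pathMatrix (m + 1) *ᵥ (fun i => x i) =
      2 * ∑ i ∈ range m, x i * x (i + 1) := by
  let N : Matrix (Fin (m + 1)) (Fin (m + 1)) ℝ := of fun i j => if (i : ℕ) + 1 = j then 1 else 0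
  have hN : pathMatrix (m + 1) = N + Nᵀ := by
    ext i j
    simp only [pathMatrix, N, of_apply, Matrix.add_apply, transpose_apply]
    grind
  have hx : (fun i : Fin (m + 1) => x i) ⬝ᵥ N *ᵥ (fun i => x i)
      = ∑ i ∈ range m, x i * x (i + 1) := by
    simp only [dotProduct]
    rw [Fin.sum_univ_castSucc]
    have h1 : (N *ᵥ fun i => x i) (Fin.last m) = 0 := by
      simp only [mulVec, dotProduct, N, of_apply]
      exact Finset.sum_eq_zero fun j _ => by rw [if_neg (by simp; omega), zero_mul]
    have h2 : ∀ i : Fin m, (N *ᵥ fun i => x i) i.castSucc = x (i + 1) := fun i => by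
      simp only [mulVec, dotProduct, N, of_apply]
      rw [Finset.sum_eq_single i.succ]
      · simp
      · intro b _ hb
        rw [if_neg, zero_mul]
        intro h
        exact hb (Fin.ext (by simpa using h.symm))
      · simp
    rw [h1, mul_zero, add_zero, ← Fin.sum_univ_eq_sum_range (fun i => x i * x (i + 1))]
    exact Finset.sum_congr rfl fun i _ => by rw [h2]; rfl
  rw [hN, add_mulVec, dotProduct_add, hx, mulVec_transpose, dotProduct_comm _ (_ ᵥ* _),
    ← dotProduct_mulVec, hx]
  ring

/-- The form of the path on `2k + 2` vertices as a sum of squares, on vectors whose entries on each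
of the pairs `{0, 1}, {2, 3}, …` are `a j, ε * a j`. With `ε = -1` this gives a negative definite
subspace, with `ε = 1` a nonnegative one. -/
theorem two_mul_sum_range_eq (k : ℕ) (ε : ℝ) (a x : ℕ → ℝ) (h0 : ∀ j ≤ k, x (2 * j) = a j)
    (h1 : ∀ j ≤ k, x (2 * j + 1) = ε * a j) :
    2 * ∑ i ∈ range (2 * k + 1), x i * x (i + 1) =
      ε * (a 0 ^ 2 + a k ^ 2 + ∑ j ∈ range k, (a j + a (j + 1)) ^ 2) := by
  induction k with
  | zero =>
    have e0 := h0 0 le_rfl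
    have e1 := h1 0 le_rfl
    simp only [mul_zero, zero_add] at e0 e1
    simp [e0, e1]
    ring
  | succ k ih =>
    have ih := ih (fun j hj => h0 j (by omega)) (fun j hj => h1 j (by omega))
    have e0 := h0 (k + 1) le_rfl
    have e1 := h1 (k + 1) le_rfl
    have e2 := h1 k (by omega)
    rw [show 2 * (k + 1) + 1 = 2 * k + 1 + 1 + 1 by ring, sum_range_succ, sum_range_succ, mul_add,
      mul_add, ih, sum_range_succ _ k]
    rw [show 2 * (k + 1) = 2 * k + 1 + 1 by ring] at e0 e1
    rw [e0, e1, e2]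
    ring

/-- The map `a ↦ (a₀, -a₀, a₁, -a₁, …)`, whose image is a negative definite subspace of dimension
`k + 1` for the form of the path on `2k + 2` vertices. -/
noncomputable def alternating (k : ℕ) : (Fin (k + 1) → ℝ) →ₗ[ℝ] (Fin (2 * k + 2) → ℝ) where
  toFun a i := (if Even (i : ℕ) then 1 else -1) * a ⟨i / 2, by omega⟩
  map_add' a b := by ext i; simp [mul_add]
  map_smul' r a := by ext i; simp

theorem alternating_form_neg (k : ℕ) {a : Fin (k + 1) → ℝ} (ha : a ≠ 0) :
    alternating k a ⬝ᵥ pathMatrix (2 * k + 2) *ᵥ alternating k a < 0 := by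
  let b : ℕ → ℝ := fun j => if h : j < k + 1 then a ⟨j, h⟩ else 0
  let x : ℕ → ℝ := fun i => (if Even i then 1 else -1) * b (i / 2)
  have hx : alternating k a = fun i : Fin (2 * k + 1 + 1) => x i := by
    ext i
    simp only [x, b, dif_pos (show (i : ℕ) / 2 < k + 1 by omega)]
    rfl
  have h := dotProduct_pathMatrix_mulVec (2 * k + 1) x
  rw [two_mul_sum_range_eq k (-1) b x (fun j _ => by simp [x])
    (fun j _ => by simp [x, show (2 * j + 1) / 2 = j by omega])] at h
  rw [hx, h]
  by_contra hneg
  have hs : 0 ≤ ∑ j ∈ range k, (b j + b (j + 1)) ^ 2 := Finset.sum_nonneg fun _ _ => sq_nonneg _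
  have h0 : b 0 = 0 := by nlinarith [sq_nonneg (b 0), sq_nonneg (b k)]
  have hs0 : ∑ j ∈ range k, (b j + b (j + 1)) ^ 2 = 0 := by
    nlinarith [sq_nonneg (b 0), sq_nonneg (b k)]
  rw [Finset.sum_eq_zero_iff_of_nonneg fun _ _ => sq_nonneg _] at hs0
  have hb : ∀ j ≤ k, b j = 0 := by
    intro j
    induction j with
    | zero => exact fun _ => h0
    | succ j ih =>
      intro hj
      have := hs0 j (mem_range.2 hj)
      rw [ih (by omega), zero_add] at this
      exact pow_eq_zero_iff two_ne_zero |>.1 this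
  refine ha (funext fun i => ?_)
  have := hb i (by omega)
  rwa [show b i = a i from dif_pos i.2] at this

/-- The map `y ↦ (y₀ - y₁, y₂ - y₃, …)`; the form of the path is nonnegative on its kernel. -/
def pairDiff (k : ℕ) : (Fin (2 * k + 2) → ℝ) →ₗ[ℝ] (Fin (k + 1) → ℝ) where
  toFun y j := y ⟨2 * j, by omega⟩ - y ⟨2 * j + 1, by omega⟩
  map_add' a b := by ext i; simp; ring
  map_smul' r a := by ext i; simp; ring

theorem form_nonneg_of_pairDiff_eq_zero (k : ℕ) {y : Fin (2 * k + 2) → ℝ} (hy : pairDiff k y = 0) :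
    0 ≤ y ⬝ᵥ pathMatrix (2 * k + 2) *ᵥ y := by
  let x : ℕ → ℝ := fun i => if h : i < 2 * k + 2 then y ⟨i, h⟩ else 0
  have hx : y = fun i : Fin (2 * k + 1 + 1) => x i := by
    ext i
    simp [x]
  have h := dotProduct_pathMatrix_mulVec (2 * k + 1) x
  rw [two_mul_sum_range_eq k 1 (fun j => x (2 * j)) x (fun j _ => rfl) fun j hj => ?_] at h
  · rw [hx, h]
    have hs : 0 ≤ ∑ j ∈ range k, (x (2 * j) + x (2 * (j + 1))) ^ 2 :=
      Finset.sum_nonneg fun _ _ => sq_nonneg _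
    positivity
  · have := congrFun hy ⟨j, by omega⟩
    simp only [pairDiff, LinearMap.coe_mk, AddHom.coe_mk, Pi.zero_apply] at this
    simp only [x, show 2 * j < 2 * k + 2 by omega, show 2 * j + 1 < 2 * k + 2 by omega, dif_pos]
    linarith

end PathMatrix

/-! ### The Schur complement with respect to an induced path -/

section SchurComplement

theorem factorization_apply {n : ℕ} {W : Type*} (C : Matrix W (Fin n) ℝ)
    (R : Matrix (Fin n) (Fin n) ℝ) (x y : W) : (C * R * Cᵀ) x y = C x ⬝ᵥ R *ᵥ C y := by
  rw [dotProduct_mulVec]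
  rfl

variable {V : Type*} (G : SimpleGraph V) [DecidableRel G.Adj]

/-- The rows of the adjacency matrix restricted to the columns of an induced path: the row of `x`
is the indicator of the neighbors of `x` on the path. -/
def attachMatrix {n : ℕ} (p : SimpleGraph.pathGraph n ↪g G) : Matrix V (Fin n) ℝ :=
  of fun x i => if G.Adj x (p i) then 1 else 0

variable {G}

theorem attachMatrix_apply {n : ℕ} (p : SimpleGraph.pathGraph n ↪g G) (x : V) (i : Fin n) :
    attachMatrix G p x i = if G.Adj x (p i) then 1 else 0 := rfl

theorem attachMatrix_embedding {n : ℕ} (p : SimpleGraph.pathGraph n ↪g G) (i j : Fin n) :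
    attachMatrix G p (p i) j = pathMatrix n i j := by
  simp [attachMatrix, pathMatrix, SimpleGraph.pathGraph_adj]

variable [DecidableEq V]

/-- The matrix of the inclusion of the coordinates of an induced path into those of `G`. -/
def embedMatrix {n : ℕ} (p : SimpleGraph.pathGraph n ↪g G) : Matrix V (Fin n) ℝ :=
  of fun x i => if x = p i then 1 else 0

variable [Fintype V]

theorem adjMatrix_mul_embedMatrix {n : ℕ} (p : SimpleGraph.pathGraph n ↪g G) :
    G.adjMatrix ℝ * embedMatrix p = attachMatrix G p := by
  ext x i
  simp [mul_apply, embedMatrix, attachMatrix, SimpleGraph.adjMatrix_apply]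

theorem embedMatrix_transpose_mul_attachMatrix {n : ℕ} (p : SimpleGraph.pathGraph n ↪g G) :
    (embedMatrix p)ᵀ * attachMatrix G p = pathMatrix n := by
  ext i j
  rw [← attachMatrix_embedding p i j]
  simp [mul_apply, embedMatrix]

theorem dotProduct_adjMatrix_embed {n : ℕ} (p : SimpleGraph.pathGraph n ↪g G) (b : Fin n → ℝ) :
    (embedMatrix p *ᵥ b) ⬝ᵥ G.adjMatrix ℝ *ᵥ (embedMatrix p *ᵥ b) = b ⬝ᵥ pathMatrix n *ᵥ b := by
  rw [mulVec_mulVec, adjMatrix_mul_embedMatrix, dotProduct_comm (embedMatrix p *ᵥ b),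
    dotProduct_mulVec, ← mulVec_transpose, mulVec_mulVec, embedMatrix_transpose_mul_attachMatrix,
    dotProduct_comm]

variable {k : ℕ}

theorem le_negInertia (p : SimpleGraph.pathGraph (2 * k + 2) ↪g G) : k + 1 ≤ negInertia G := by
  have h := finrank_le_card_neg_eigenvalues (G.isHermitian_adjMatrix ℝ)
    ((embedMatrix p).mulVecLin ∘ₗ alternating k) fun z hz => by
      change (embedMatrix p *ᵥ alternating k z) ⬝ᵥ _ *ᵥ (embedMatrix p *ᵥ alternating k z) < 0
      rw [dotProduct_adjMatrix_embed]
      exact alternating_form_neg k hz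
  rwa [Module.finrank_fin_fun] at h

/-- If the adjacency matrix is `C R Cᵀ` with `R` the inverse of the path matrix `B`, then its form
at `z` is the form of `B` at `R Cᵀ z`, so it has no more negative directions than `B`. -/
theorem negInertia_le_of_factorization (p : SimpleGraph.pathGraph (2 * k + 2) ↪g G)
        (h : G.adjMatrix ℝ
      = attachMatrix G p * pathInvMatrix (2 * k + 2) * (attachMatrix G p)ᵀ) :
    negInertia G ≤ k + 1 := by
  have hn : Even (2 * k + 2) := ⟨k + 1, by ring⟩
  have h := card_neg_eigenvalues_le_finrank (G.isHermitian_adjMatrix ℝ)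
    (pairDiff k ∘ₗ (pathInvMatrix (2 * k + 2) * (attachMatrix G p)ᵀ).mulVecLin) fun z hz => by
      refine (form_nonneg_of_pairDiff_eq_zero k hz).trans_eq ?_
      simp only [mulVecLin_apply]
      rw [mulVec_mulVec, ← Matrix.mul_assoc, pathMatrix_mul_pathInvMatrix hn, Matrix.one_mul, h,
        mulVec_transpose, dotProduct_comm, ← dotProduct_mulVec, mulVec_mulVec, ← Matrix.mul_assoc]
  rwa [Module.finrank_fin_fun] at h

/-- The Schur complement of an induced path on `2k + 2` vertices is positive semidefinite when
`n(G) ≤ k + 1`: the path already carries a negative definite subspace of dimension `k + 1`, and a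
vector where the Schur complement is negative would give one more negative direction, orthogonal to
all vectors supported on the path. -/
theorem posSemidef_schurComplement (p : SimpleGraph.pathGraph (2 * k + 2) ↪g G)
    (h : negInertia G ≤ k + 1) :
    (G.adjMatrix ℝ
      - attachMatrix G p * pathInvMatrix (2 * k + 2) * (attachMatrix G p)ᵀ).PosSemidef := by
  have hn : Even (2 * k + 2) := ⟨k + 1, by ring⟩
  set A := G.adjMatrix ℝ with hA
  set C := attachMatrix G p with hC
  set R := pathInvMatrix (2 * k + 2) with hR
  set J := embedMatrix p with hJ
  have hAt : Aᵀ = A := SimpleGraph.transpose_adjMatrix G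
  have hJA : Jᵀ * A = Cᵀ := by
    rw [hC, ← adjMatrix_mul_embedMatrix, transpose_mul, ← hA, hAt]
  refine PosSemidef.of_dotProduct_mulVec_nonneg ?_ fun z => ?_
  · rw [IsHermitian, conjTranspose_eq_transpose_of_trivial, transpose_sub, hAt, transpose_mul,
      transpose_mul, transpose_transpose, pathInvMatrix_transpose, Matrix.mul_assoc]
  rw [star_trivial]
  by_contra hneg
  rw [not_le] at hneg
  set w : V → ℝ := (A - C * R * Cᵀ) *ᵥ z with hw
  -- The correction of `z` by a vector on the path that makes it orthogonal to the path.
  let u : V → ℝ := z - (J * R * Cᵀ) *ᵥ z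
  have hAu : A *ᵥ u = w := by
    simp only [u, hw]
    rw [mulVec_sub, mulVec_mulVec, sub_mulVec, ← Matrix.mul_assoc, ← Matrix.mul_assoc,
      adjMatrix_mul_embedMatrix]
  have hJw : Jᵀ *ᵥ w = 0 := by
    rw [hw, mulVec_mulVec, Matrix.mul_sub, hJA, ← Matrix.mul_assoc, ← Matrix.mul_assoc,
      embedMatrix_transpose_mul_attachMatrix, pathMatrix_mul_pathInvMatrix hn, Matrix.one_mul,
      sub_self, zero_mulVec]
  have hbw : ∀ b, (J *ᵥ b) ⬝ᵥ w = 0 := fun b => by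
    rw [dotProduct_comm, dotProduct_mulVec, ← mulVec_transpose, hJw, zero_dotProduct]
  have huw : u ⬝ᵥ w = z ⬝ᵥ w := by
    simp only [u, sub_dotProduct]
    rw [Matrix.mul_assoc, ← mulVec_mulVec, hbw, sub_zero]
  -- The negative directions of the path together with `u`: one too many.
  let L : ((Fin (k + 1) → ℝ) × ℝ) →ₗ[ℝ] V → ℝ :=
    (J.mulVecLin ∘ₗ alternating k).coprod (LinearMap.toSpanSingleton ℝ _ u)
  have hform : ∀ y : (Fin (k + 1) → ℝ) × ℝ, L y ⬝ᵥ A *ᵥ L y =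
      alternating k y.1 ⬝ᵥ pathMatrix (2 * k + 2) *ᵥ alternating k y.1 + y.2 ^ 2 * (z ⬝ᵥ w) := by
    intro y
    have hL : L y = J *ᵥ alternating k y.1 + y.2 • u := by simp [L]
    have hsym : u ⬝ᵥ A *ᵥ (J *ᵥ alternating k y.1) = 0 := by
      rw [dotProduct_mulVec, ← mulVec_transpose, hAt, hAu, dotProduct_comm, hbw]
    rw [hL, mulVec_add, dotProduct_add, add_dotProduct, add_dotProduct, dotProduct_adjMatrix_embed,
      mulVec_smul, hAu]
    simp only [smul_dotProduct, dotProduct_smul, hsym, hbw, huw, smul_eq_mul]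
    ring
  have := finrank_le_card_neg_eigenvalues (G.isHermitian_adjMatrix ℝ) L fun y hy => by
    rw [hform]
    by_cases h1 : y.1 = 0
    · have h2 : y.2 ≠ 0 := fun h2 => hy (Prod.ext h1 h2)
      rw [h1, map_zero, zero_dotProduct, zero_add]
      exact mul_neg_of_pos_of_neg (by positivity) hneg
    · have := alternating_form_neg k h1
      nlinarith [sq_nonneg y.2]
  rw [Module.finrank_prod, Module.finrank_fin_fun, Module.finrank_self] at this
  exact absurd (this.trans h) (by omega)

/-- A positive semidefinite matrix with nonpositive diagonal is zero; hence the Schur complement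
vanishes if its diagonal entries, the negatives of the quantities in `hdiag`, are nonpositive. -/
theorem adjMatrix_factorization (p : SimpleGraph.pathGraph (2 * k + 2) ↪g G)
    (h : negInertia G ≤ k + 1)
    (hdiag : ∀ x, 0 ≤ attachMatrix G p x ⬝ᵥ pathInvMatrix (2 * k + 2) *ᵥ attachMatrix G p x) :
    G.adjMatrix ℝ = attachMatrix G p * pathInvMatrix (2 * k + 2) * (attachMatrix G p)ᵀ := by
  have hpsd := posSemidef_schurComplement p h
  refine sub_eq_zero.1 (hpsd.trace_eq_zero_iff.1 (le_antisymm ?_ hpsd.trace_nonneg))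
  refine Finset.sum_nonpos fun x _ => ?_
  rw [diag_apply, Matrix.sub_apply, factorization_apply, SimpleGraph.adjMatrix_apply,
    if_neg (SimpleGraph.irrefl G)]
  linarith [hdiag x]

end SchurComplement

/-! ### The graphs `G₁(k, t)` factor through the inverse path matrix -/

section G1Factorization

variable {k t : ℕ}

/-- The indicator of the neighbors on the path `v₁ … v_{2k+2}` of a vertex of `G₁(k, t)`, as a
vector on the positions of the path. -/
def G1Vertex.vec : G1Vertex k t → Fin (2 * k + 2) → ℝ
  | .spine i _ => posVec (2 * k + 2) (i - 1) + posVec (2 * k + 2) (i + 1)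
  | .single i _ => posVec (2 * k + 2) i
  | .double i _ => posVec (2 * k + 2) i + posVec (2 * k + 2) (i + 1)

/-- A vertex of `G₁(k, t)` is determined by its neighbors on the path. This is why the indices `2`
and `2k + 1` are missing among the `a_i`: they would repeat `v_1` and `v_{2k+2}`. -/
theorem G1Vertex.vec_injective (ht : t ≤ k) :
    Function.Injective (G1Vertex.vec : G1Vertex k t → Fin (2 * k + 2) → ℝ) := by
  let touches : G1Vertex k t → ℕ → Prop
    | .spine i _, m => m + 1 = i ∨ m = i + 1
    | .single i _, m => m = i
    | .double i _, m => m = i ∨ m = i + 1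
  have hv : ∀ q m (hm : 1 ≤ m ∧ m ≤ 2 * k + 2),
      q.vec ⟨m - 1, by omega⟩ = 1 ↔ touches q m := by
    intro q m hm
    cases q <;> simp only [vec, touches, posVec_apply, Pi.add_apply] <;> grind
  intro q r h
  have key : ∀ m, 1 ≤ m ∧ m ≤ 2 * k + 2 → (touches q m ↔ touches r m) := fun m hm => by
    rw [← hv q m hm, ← hv r m hm, h]
  rcases q with ⟨i, hi⟩ | ⟨i, hi⟩ | ⟨i, hi⟩ <;> rcases r with ⟨j, hj⟩ | ⟨j, hj⟩ | ⟨j, hj⟩ <;>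
    simp only [touches] at key <;>
    have k1 := key (i - 1) <;> have k2 := key i <;> have k3 := key (i + 1) <;>
    have k4 := key (j - 1) <;> have k5 := key j <;> have k6 := key (j + 1) <;> clear key <;>
    simp only [spine.injEq, single.injEq, double.injEq, reduceCtorEq] <;> grind

theorem G1_adj {q r : G1Vertex k t} :
    (G1 k t).Adj q r ↔ q ≠ r ∧ (G1Edge k t q r ∨ G1Edge k t r q) :=
  SimpleGraph.fromRel_adj _ _ _

open Classical in
theorem G1_adj_spine_left (i : ℕ) (hi : 1 ≤ i ∧ i ≤ 2 * k + 2) (r : G1Vertex k t) :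
    (if (G1 k t).Adj (.spine i hi) r then 1 else 0) = r.vec ⟨i - 1, by omega⟩ := by
  rcases r with ⟨j, hj⟩ | ⟨j, hj⟩ | ⟨j, hj⟩ <;>
    simp only [G1_adj, G1Edge, G1Vertex.vec, posVec_apply, Pi.add_apply, ne_eq,
      G1Vertex.spine.injEq, reduceCtorEq] <;> grind

theorem vec_spine_eq (i : ℕ) (hi : 1 ≤ i ∧ i ≤ 2 * k + 2) :
    (G1Vertex.spine i hi : G1Vertex k t).vec = (pathMatrix (2 * k + 2)).col ⟨i - 1, by omega⟩ := by
  rw [pathMatrix_col]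
  simp only [G1Vertex.vec, show i - 1 + 2 = i + 1 by omega]

theorem vec_spine_dotProduct (i : ℕ) (hi : 1 ≤ i ∧ i ≤ 2 * k + 2) (x : Fin (2 * k + 2) → ℝ) :
    (G1Vertex.spine i hi : G1Vertex k t).vec ⬝ᵥ pathInvMatrix (2 * k + 2) *ᵥ x
      = x ⟨i - 1, by omega⟩ := by
  have hn : Even (2 * k + 2) := ⟨k + 1, by ring⟩
  rw [vec_spine_eq, ← mulVec_single_one, dotProduct_mulVec, ← mulVec_transpose, mulVec_mulVec,
    pathInvMatrix_transpose, pathInvMatrix_mul_pathMatrix hn, one_mulVec, single_one_dotProduct]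

open Classical in
/-- Adjacency in `G₁(k, t)` is given by the bilinear form of the inverse path matrix on the
neighborhoods on the path. -/
theorem G1_adj_eq_form (ht : t ≤ k) (q r : G1Vertex k t) :
    (if (G1 k t).Adj q r then 1 else 0) = q.vec ⬝ᵥ pathInvMatrix (2 * k + 2) *ᵥ r.vec := by
  have hn : Even (2 * k + 2) := ⟨k + 1, by ring⟩
  have symm : ∀ q r : G1Vertex k t, q.vec ⬝ᵥ pathInvMatrix (2 * k + 2) *ᵥ r.vec =
      r.vec ⬝ᵥ pathInvMatrix (2 * k + 2) *ᵥ q.vec := fun q r => by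
    rw [dotProduct_mulVec, ← mulVec_transpose, pathInvMatrix_transpose, dotProduct_comm]
  have sd : ∀ (i : ℕ) (hi) (j : ℕ) (hj),
      (if (G1 k t).Adj (.single i hi) (.double j hj) then 1 else 0) =
        (G1Vertex.single i hi).vec ⬝ᵥ pathInvMatrix (2 * k + 2) *ᵥ (G1Vertex.double j hj).vec := by
    intro i hi j hj
    simp only [G1_adj, G1Edge, G1Vertex.vec, mulVec_add, dotProduct_add]
    rw [posVec_dotProduct_posVec hn (by omega) (by omega),
      posVec_dotProduct_posVec hn (by omega) (by omega)]
    by_cases h1 : i = 2 * t + 1 ∧ j = 2 * t + 2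
    · obtain ⟨rfl, rfl⟩ := h1
      rw [pathInv_succ (by grind), pathInv_eq_zero (by grind)]
      simp
    · by_cases h2 : i = 2 * t + 2 ∧ j = 2 * t
      · obtain ⟨rfl, rfl⟩ := h2
        rw [pathInv_comm _ (2 * t + 1), pathInv_succ (by grind), pathInv_eq_zero (by grind)]
        simp
      · rw [pathInv_eq_zero (by grind), pathInv_eq_zero (by grind)]
        simp [h1, h2]
  rcases q with ⟨i, hi⟩ | ⟨i, hi⟩ | ⟨i, hi⟩
  · rw [vec_spine_dotProduct, G1_adj_spine_left]
  · rcases r with ⟨j, hj⟩ | ⟨j, hj⟩ | ⟨j, hj⟩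
    · rw [symm, vec_spine_dotProduct, ← G1_adj_spine_left, SimpleGraph.adj_comm]
    · simp only [G1_adj, G1Edge, G1Vertex.vec, ne_eq, G1Vertex.single.injEq]
      rw [posVec_dotProduct_posVec hn (by omega) (by omega)]
      by_cases h1 : i = 2 * t + 1 ∧ j = 2 * t + 2
      · obtain ⟨rfl, rfl⟩ := h1
        rw [pathInv_succ (by grind)]
        simp
      · by_cases h2 : j = 2 * t + 1 ∧ i = 2 * t + 2
        · obtain ⟨rfl, rfl⟩ := h2
          rw [pathInv_comm, pathInv_succ (by grind)]
          simp
        · rw [pathInv_eq_zero (by grind)]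
          simp [h1, h2]
    · exact sd i hi j hj
  · rcases r with ⟨j, hj⟩ | ⟨j, hj⟩ | ⟨j, hj⟩
    · rw [symm, vec_spine_dotProduct, ← G1_adj_spine_left, SimpleGraph.adj_comm]
    · rw [symm, ← sd, SimpleGraph.adj_comm]
    · simp only [G1_adj, G1Edge, G1Vertex.vec, mulVec_add, dotProduct_add, add_dotProduct, ne_eq,
        G1Vertex.double.injEq]
      rw [posVec_dotProduct_posVec hn (by omega) (by omega),
        posVec_dotProduct_posVec hn (by omega) (by omega),
        posVec_dotProduct_posVec hn (by omega) (by omega),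
        posVec_dotProduct_posVec hn (by omega) (by omega),
        pathInv_eq_zero (i := i) (j := j) (by grind),
        pathInv_eq_zero (i := i + 1) (j := j + 1) (by grind)]
      by_cases h1 : i = 2 * t ∧ j = 2 * t + 2
      · obtain ⟨rfl, rfl⟩ := h1
        rw [pathInv_succ (by grind), pathInv_eq_zero (by grind)]
        simp
      · by_cases h2 : j = 2 * t ∧ i = 2 * t + 2
        · obtain ⟨rfl, rfl⟩ := h2
          rw [pathInv_comm _ (2 * t + 1), pathInv_succ (by grind), pathInv_eq_zero (by grind)]
          simp
        · rw [pathInv_eq_zero (by grind), pathInv_eq_zero (by grind)]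
          simp [h1, h2]

end G1Factorization

/-! ### Distances and geodesics -/

section Distance

variable {V : Type*} {G : SimpleGraph V}

/-- A function that grows by at most one along each edge grows by at most the distance. -/
theorem le_add_dist_of_lipschitz (hconn : G.Connected) {φ : V → ℕ}
    (hφ : ∀ x y, G.Adj x y → φ y ≤ φ x + 1) (x y : V) : φ y ≤ φ x + G.dist x y := by
  obtain ⟨w, hw⟩ := hconn.exists_walk_length_eq_dist x y
  rw [← hw]
  clear hw
  induction w with
  | nil => simp
  | cons h w ih =>
    have := hφ _ _ h
    rw [SimpleGraph.Walk.length_cons]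
    omega

/-- A shortest walk as an induced path along which the distance in `G` is the distance in the path.
-/
theorem exists_geodesic (hconn : G.Connected) {u v : V} {m : ℕ} (huv : G.dist u v = m) :
    ∃ p : SimpleGraph.pathGraph (m + 1) ↪g G,
      ∀ i j : Fin (m + 1), (j : ℕ) ≤ i + G.dist (p i) (p j) := by
  obtain ⟨w, hw⟩ := hconn.exists_walk_length_eq_dist u v
  have hdist : ∀ i : Fin (m + 1), G.dist u (w.getVert i) = i := fun i => by
    have h1 : G.dist u (w.getVert i) ≤ i :=
      (SimpleGraph.dist_le (w.take i)).trans (by rw [SimpleGraph.Walk.take_length]; omega)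
    have h2 : G.dist (w.getVert i) v ≤ m - i :=
      (SimpleGraph.dist_le (w.drop i)).trans (by rw [SimpleGraph.Walk.drop_length]; omega)
    have h3 := hconn.dist_triangle (u := u) (v := w.getVert i) (w := v)
    omega
  have hle : ∀ i j : Fin (m + 1), (j : ℕ) ≤ i + G.dist (w.getVert i) (w.getVert j) :=
    fun i j => by
      have h3 := hconn.dist_triangle (u := u) (v := w.getVert i) (w := w.getVert j)
      rwa [hdist, hdist] at h3
  refine ⟨⟨⟨fun i => w.getVert i, fun i j h => ?_⟩, fun {i j} => ?_⟩, hle⟩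
  · have h1 := hdist i
    have h2 := hdist j
    simp only at h
    rw [h, h2] at h1
    exact Fin.ext h1.symm
  · rw [SimpleGraph.pathGraph_adj]
    change G.Adj (w.getVert i) (w.getVert j) ↔ _
    refine ⟨fun h => ?_, ?_⟩
    · have h1 := hle i j
      have h2 := hle j i
      rw [SimpleGraph.dist_eq_one_iff_adj.2 h] at h1
      rw [SimpleGraph.dist_eq_one_iff_adj.2 h.symm] at h2
      have h3 : (i : ℕ) ≠ j := fun h3 => by
        rw [h3] at h
        exact G.irrefl h
      omega
    · rintro (h | h)
      · rw [← h]
        exact w.adj_getVert_succ (by omega)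
      · rw [← h]
        exact (w.adj_getVert_succ (by omega)).symm

end Distance

/-! ### A level function on `G₁(k, t)` -/

section Level

variable {k t : ℕ}

/-- A function on `G₁(k, t)` that follows the index along the path `v₁ … v_{2k+2}` and varies by at
most one along the edges. The values `l` and `r` are those at `a_1` and `a_{2k+2}`: with `l = 1`
and `r = 2k + 2` it bounds the length of the path from below; `l = 0` or `r = 2k + 3`, admissible
in the absence of `c_2` or `c_{2k}`, shows that `a_1` or `a_{2k+2}` is too far from the other end.
-/
def G1Vertex.level (l r : ℕ) : G1Vertex k t → ℕ
  | .spine i _ => i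
  | .single i _ => if i = 1 then l else if i = 2 * k + 2 then r else i
  | .double i _ => if i = 2 * t then i + 1 else i

theorem G1Vertex.level_le_of_adj {l r : ℕ} {q q' : G1Vertex k t}
    (hl : l = 1 ∨ l = 0 ∧ ∀ h, q ≠ .double 2 h ∧ q' ≠ .double 2 h)
    (hr : r = 2 * k + 2 ∨ r = 2 * k + 3 ∧ ∀ h, q ≠ .double (2 * k) h ∧ q' ≠ .double (2 * k) h)
    (h : (G1 k t).Adj q q') : q'.level l r ≤ q.level l r + 1 := by
  rw [G1_adj] at h
  rcases q with ⟨i, hi⟩ | ⟨i, hi⟩ | ⟨i, hi⟩ <;> rcases q' with ⟨j, hj⟩ | ⟨j, hj⟩ | ⟨j, hj⟩ <;>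
    simp only [G1Edge, level, ne_eq, G1Vertex.spine.injEq, G1Vertex.single.injEq,
      G1Vertex.double.injEq, reduceCtorEq] at h hl hr ⊢ <;> grind

end Level

/-! ### Graphs between the path and `G₁(k, t)` -/

section Sufficiency

variable {V : Type*} {G : SimpleGraph V}

theorem dist_pathGraph_embedding_le (hconn : G.Connected) {n : ℕ}
    (p : SimpleGraph.pathGraph n ↪g G) {i j : Fin n} (hij : i ≤ j) :
    G.dist (p i) (p j) ≤ j - i := by
  obtain ⟨j, hj⟩ := j
  induction j with
  | zero =>
    have : i = ⟨0, hj⟩ := Fin.ext (by simpa [Fin.le_def] using hij)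
    simp [this]
  | succ j ih =>
    rcases hij.eq_or_lt with rfl | hlt
    · simp
    · have hle : i ≤ ⟨j, by omega⟩ := by simp only [Fin.lt_def, Fin.le_def] at hlt ⊢; omega
      have h1 := ih (by omega) hle
      have h2 : G.Adj (p ⟨j, by omega⟩) (p ⟨j + 1, hj⟩) := by
        rw [p.map_adj_iff, SimpleGraph.pathGraph_adj]
        exact Or.inl rfl
      have h3 := hconn.dist_triangle (u := p i) (v := p ⟨j, by omega⟩) (w := p ⟨j + 1, hj⟩)
      rw [SimpleGraph.dist_eq_one_iff_adj.2 h2] at h3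
      simp only [Fin.le_def] at hle h1 ⊢
      omega

variable {k t : ℕ} {p : SimpleGraph.pathGraph (2 * k + 2) ↪g G} {f : G ↪g G1 k t}

theorem apply_eq_spine (hf : ∀ i, f (p i) = spineVertex k t i) {i : ℕ}
    (hi : 1 ≤ i ∧ i ≤ 2 * k + 2) : f (p ⟨i - 1, by omega⟩) = .spine i hi := by
  rw [hf, spineVertex]
  congr
  simp only
  omega

theorem adj_of_single (hf : ∀ i, f (p i) = spineVertex k t i) {x : V} {i : ℕ} {h}
    (hx : f x = .single i h) (hi : 1 ≤ i ∧ i ≤ 2 * k + 2) : G.Adj x (p ⟨i - 1, by omega⟩) := by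
  rw [← f.map_adj_iff, hx, apply_eq_spine hf hi, G1_adj]
  exact ⟨by simp, Or.inr rfl⟩

theorem adj_of_double (hf : ∀ i, f (p i) = spineVertex k t i) {x : V} {i j : ℕ} {h}
    (hx : f x = .double i h) (hi : 1 ≤ j ∧ j ≤ 2 * k + 2) (hij : j = i ∨ j = i + 1) :
    G.Adj x (p ⟨j - 1, by omega⟩) := by
  rw [← f.map_adj_iff, hx, apply_eq_spine hf hi, G1_adj]
  exact ⟨by simp, Or.inr hij⟩

/-- Apart from `a_1` and `a_{2k+2}`, every vertex is within distance one of an inner vertex of the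
path. -/
theorem exists_near_inner (hk : 1 ≤ k) (ht : t ≤ k) (hconn : G.Connected)
    (hf : ∀ i, f (p i) = spineVertex k t i) (x : V) :
    (∃ i : Fin (2 * k + 2), 1 ≤ (i : ℕ) ∧ (i : ℕ) ≤ 2 * k ∧ G.dist x (p i) ≤ 1) ∨
      (∃ h, f x = .single 1 h) ∨ ∃ h, f x = .single (2 * k + 2) h := by
  rcases hx : f x with ⟨i, hi⟩ | ⟨i, hi⟩ | ⟨i, hi⟩
  · left
    have hxp : x = p ⟨i - 1, by omega⟩ := f.injective (by rw [hx, apply_eq_spine hf hi])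
    rw [hxp]
    rcases Nat.lt_or_ge i 2 with h2 | h2
    · refine ⟨⟨1, by omega⟩, by simp, by simp only; omega, ?_⟩
      refine (dist_pathGraph_embedding_le hconn p (i := ⟨i - 1, by omega⟩) (j := ⟨1, by omega⟩)
        (by simp only [Fin.le_def]; omega)).trans ?_
      simp
    · rcases Nat.lt_or_ge (2 * k + 1) i with h3 | h3
      · refine ⟨⟨2 * k, by omega⟩, by simp; omega, le_rfl, ?_⟩
        rw [SimpleGraph.dist_comm]
        refine (dist_pathGraph_embedding_le hconn p (by simp only [Fin.le_def]; omega)).trans ?_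
        simp
        omega
      · exact ⟨⟨i - 1, by omega⟩, by simp; omega, by simp; omega, by simp⟩
  · by_cases h1 : i = 1
    · subst h1
      exact Or.inr (Or.inl ⟨hi, rfl⟩)
    by_cases h2 : i = 2 * k + 2
    · subst h2
      exact Or.inr (Or.inr ⟨hi, rfl⟩)
    left
    have hi' : 1 ≤ i ∧ i ≤ 2 * k + 2 := by omega
    refine ⟨⟨i - 1, by omega⟩, by simp; omega, by simp; omega, ?_⟩
    exact (SimpleGraph.dist_eq_one_iff_adj.2 (adj_of_single hf hx hi')).le
  · left
    have hi' : 1 ≤ i ∧ i ≤ 2 * k + 2 := by omega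
    refine ⟨⟨i - 1, by omega⟩, by simp; omega, by simp; omega, ?_⟩
    exact (SimpleGraph.dist_eq_one_iff_adj.2 (adj_of_double hf hx hi' (Or.inl rfl))).le

/-- The vertex `a_1` reaches the vertices of the path from `v_3` on, through `c_2`, as fast as
`v_1` does. -/
theorem dist_left_end_le (hk : 1 ≤ k) (hconn : G.Connected)
    (hf : ∀ i, f (p i) = spineVertex k t i) {x c y : V} {hx hc} (hfx : f x = .single 1 hx)
    (hfc : f c = .double 2 hc) {i : Fin (2 * k + 2)} (hi1 : 1 ≤ (i : ℕ)) (hi2 : (i : ℕ) ≤ 2 * k)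
    (hy : G.dist y (p i) ≤ 1) : G.dist x y ≤ 2 * k + 1 := by
  have hxc : G.Adj x c := by
    rw [← f.map_adj_iff, hfx, hfc, G1_adj]
    exact ⟨by simp, Or.inl (Or.inl (by grind))⟩
  have hx0 := adj_of_single hf hfx (by omega)
  have hc2 := adj_of_double (j := 3) hf hfc (by omega) (Or.inr rfl)
  have h1 := SimpleGraph.dist_eq_one_iff_adj.2 hxc
  have h2 := SimpleGraph.dist_eq_one_iff_adj.2 hx0
  have h3 := SimpleGraph.dist_eq_one_iff_adj.2 hc2
  have h4 := hconn.dist_triangle (u := x) (v := p i) (w := y)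
  rw [SimpleGraph.dist_comm (u := p i)] at h4
  rcases hi1.eq_or_lt with h | h
  · have h5 := hconn.dist_triangle (u := x) (v := p ⟨1 - 1, by omega⟩) (w := p i)
    have h6 := dist_pathGraph_embedding_le hconn p (i := ⟨1 - 1, by omega⟩) (j := i)
      (by simp)
    simp only at h6
    omega
  · have h5 := hconn.dist_triangle (u := x) (v := c) (w := p i)
    have h6 := hconn.dist_triangle (u := c) (v := p ⟨3 - 1, by omega⟩) (w := p i)
    have h7 := dist_pathGraph_embedding_le hconn p (i := ⟨3 - 1, by omega⟩) (j := i)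
      (by simp only [Fin.le_def]; omega)
    simp only at h7
    omega

/-- The vertex `a_{2k+2}` reaches the vertices of the path up to `v_{2k}`, through `c_{2k}`, as
fast as `v_{2k+2}` does. -/
theorem dist_right_end_le (hk : 1 ≤ k) (ht : t ≤ k) (hconn : G.Connected)
    (hf : ∀ i, f (p i) = spineVertex k t i) {x c y : V} {hx hc}
    (hfx : f x = .single (2 * k + 2) hx) (hfc : f c = .double (2 * k) hc) {i : Fin (2 * k + 2)}
    (hi1 : 1 ≤ (i : ℕ)) (hi2 : (i : ℕ) ≤ 2 * k) (hy : G.dist y (p i) ≤ 1) :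
    G.dist x y ≤ 2 * k + 1 := by
  have hxc : G.Adj x c := by
    rw [← f.map_adj_iff, hfx, hfc, G1_adj]
    exact ⟨by simp, Or.inl (Or.inr (by grind))⟩
  have hx0 := adj_of_single hf hfx (by omega)
  have hc2 := adj_of_double (j := 2 * k) hf hfc (by omega) (Or.inl rfl)
  have h1 := SimpleGraph.dist_eq_one_iff_adj.2 hxc
  have h2 := SimpleGraph.dist_eq_one_iff_adj.2 hx0
  have h3 := SimpleGraph.dist_eq_one_iff_adj.2 hc2
  have h4 := hconn.dist_triangle (u := x) (v := p i) (w := y)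
  rw [SimpleGraph.dist_comm (u := p i)] at h4
  rcases hi2.eq_or_lt with h | h
  · have h5 := hconn.dist_triangle (u := x) (v := p ⟨2 * k + 2 - 1, by omega⟩) (w := p i)
    have h6 := dist_pathGraph_embedding_le hconn p (i := i) (j := ⟨2 * k + 2 - 1, by omega⟩)
      (by simp only [Fin.le_def]; omega)
    rw [SimpleGraph.dist_comm (u := p i)] at h6
    simp only at h6
    omega
  · have h5 := hconn.dist_triangle (u := x) (v := c) (w := p i)
    have h6 := hconn.dist_triangle (u := c) (v := p ⟨2 * k - 1, by omega⟩) (w := p i)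
    have h7 := dist_pathGraph_embedding_le hconn p (i := i) (j := ⟨2 * k - 1, by omega⟩)
      (by simp only [Fin.le_def]; omega)
    rw [SimpleGraph.dist_comm (u := p i)] at h7
    simp only at h7
    omega

theorem dist_le_of_embedding (hk : 1 ≤ k) (ht : t ≤ k) (hconn : G.Connected)
    (hf : ∀ i, f (p i) = spineVertex k t i)
    (hl : ∀ v h, f v = .single 1 h → ∃ w h', f w = .double 2 h')
    (hr : ∀ v h, f v = .single (2 * k + 2) h → ∃ w h', f w = .double (2 * k) h') (x y : V) :
    G.dist x y ≤ 2 * k + 1 := by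
  rcases exists_near_inner hk ht hconn hf x with ⟨i, hi1, hi2, hi⟩ | ⟨h, hx⟩ | ⟨h, hx⟩ <;>
    rcases exists_near_inner hk ht hconn hf y with ⟨j, hj1, hj2, hj⟩ | ⟨h', hy⟩ | ⟨h', hy⟩
  · have h1 := hconn.dist_triangle (u := x) (v := p i) (w := y)
    have h2 := hconn.dist_triangle (u := p i) (v := p j) (w := y)
    rw [SimpleGraph.dist_comm (u := p j)] at h2
    rcases le_total i j with h | h
    · have h3 := dist_pathGraph_embedding_le hconn p h
      omega
    · have h3 := dist_pathGraph_embedding_le hconn p h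
      rw [SimpleGraph.dist_comm] at h3
      omega
  · obtain ⟨c, hc, hfc⟩ := hl y h' hy
    rw [SimpleGraph.dist_comm]
    exact dist_left_end_le hk hconn hf hy hfc hi1 hi2 hi
  · obtain ⟨c, hc, hfc⟩ := hr y h' hy
    rw [SimpleGraph.dist_comm]
    exact dist_right_end_le hk ht hconn hf hy hfc hi1 hi2 hi
  · obtain ⟨c, hc, hfc⟩ := hl x h hx
    exact dist_left_end_le hk hconn hf hx hfc hj1 hj2 hj
  · rw [f.injective (hx.trans hy.symm)]
    simp
  · grind
  · obtain ⟨c, hc, hfc⟩ := hr x h hx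
    exact dist_right_end_le hk ht hconn hf hx hfc hj1 hj2 hj
  · grind
  · rw [f.injective (hx.trans hy.symm)]
    simp

theorem diam_eq_of_embedding [Finite V] (hk : 1 ≤ k) (ht : t ≤ k) (hconn : G.Connected)
    (hf : ∀ i, f (p i) = spineVertex k t i)
    (hl : ∀ v h, f v = .single 1 h → ∃ w h', f w = .double 2 h')
    (hr : ∀ v h, f v = .single (2 * k + 2) h → ∃ w h', f w = .double (2 * k) h') :
    G.diam = 2 * k + 1 := by
  have := hconn.nonempty
  refine le_antisymm ?_ ?_
  · obtain ⟨u, v, huv⟩ := G.exists_dist_eq_diam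
    rw [← huv]
    exact dist_le_of_embedding hk ht hconn hf hl hr u v
  · have h1 := le_add_dist_of_lipschitz hconn (φ := fun x => (f x).level 1 (2 * k + 2))
      (fun x y h => G1Vertex.level_le_of_adj (Or.inl rfl) (Or.inl rfl) (f.map_adj_iff.2 h))
      (p 0) (p (Fin.last _))
    have h2 : G.dist (p 0) (p (Fin.last _)) ≤ G.diam :=
      SimpleGraph.dist_le_diam (SimpleGraph.connected_iff_ediam_ne_top.1 hconn)
    simp only [hf, spineVertex, G1Vertex.level, Fin.val_last, Fin.val_zero] at h1
    omega

variable [DecidableRel G.Adj]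

theorem attachMatrix_eq_vec (hf : ∀ i, f (p i) = spineVertex k t i) (x : V) :
    attachMatrix G p x = (f x).vec := by
  classical
  ext a
  have h := G1_adj_spine_left (t := t) (a + 1) (by omega) (f x)
  simp only [Nat.add_sub_cancel] at h
  rw [← h, attachMatrix_apply]
  refine if_congr ?_ rfl rfl
  rw [SimpleGraph.adj_comm, ← f.map_adj_iff, hf]
  rfl

variable [Fintype V] [DecidableEq V]

theorem negInertia_eq_of_embedding (ht : t ≤ k) (hf : ∀ i, f (p i) = spineVertex k t i) :
    negInertia G = k + 1 := by
  classical
  refine le_antisymm (negInertia_le_of_factorization p ?_) (le_negInertia p)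
  ext x y
  rw [factorization_apply, attachMatrix_eq_vec hf, attachMatrix_eq_vec hf, ← G1_adj_eq_form ht,
    SimpleGraph.adjMatrix_apply]
  simp only [f.map_adj_iff]

end Sufficiency

/-! ### Graphs with diameter `2k + 1` and negative inertia index `k + 1` -/

section Necessity

variable {V : Type*} {G : SimpleGraph V} {n k : ℕ}

/-- Without `c_2`, the vertex `a_1` would be at distance `2k + 2` from the other end of the path.
-/
theorem exists_double_left [Finite V] (hconn : G.Connected) {t : ℕ}
    {p : SimpleGraph.pathGraph (2 * k + 2) ↪g G} {f : G ↪g G1 k t}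
    (hf : ∀ i, f (p i) = spineVertex k t i) (hdiam : G.diam = 2 * k + 1) {v : V} {h}
    (hv : f v = .single 1 h) : ∃ w h', f w = .double 2 h' := by
  by_contra! hno
  have h1 := le_add_dist_of_lipschitz hconn (φ := fun x => (f x).level 0 (2 * k + 2))
    (fun x y h => G1Vertex.level_le_of_adj (Or.inr ⟨rfl, fun h' => ⟨hno x h', hno y h'⟩⟩)
      (Or.inl rfl) (f.map_adj_iff.2 h)) v (p (Fin.last _))
  have := hconn.nonempty
  have h2 : G.dist v (p (Fin.last _)) ≤ G.diam :=
    SimpleGraph.dist_le_diam (SimpleGraph.connected_iff_ediam_ne_top.1 hconn)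
  simp only [hf, hv, spineVertex, G1Vertex.level, Fin.val_last, if_true] at h1
  omega

/-- Without `c_{2k}`, the vertex `a_{2k+2}` would be at distance `2k + 2` from the other end of the
path. -/
theorem exists_double_right [Finite V] (hconn : G.Connected) {t : ℕ}
    {p : SimpleGraph.pathGraph (2 * k + 2) ↪g G} {f : G ↪g G1 k t}
    (hf : ∀ i, f (p i) = spineVertex k t i) (hdiam : G.diam = 2 * k + 1) {v : V} {h}
    (hv : f v = .single (2 * k + 2) h) : ∃ w h', f w = .double (2 * k) h' := by
  by_contra! hno
  have h1 := le_add_dist_of_lipschitz hconn (φ := fun x => (f x).level 1 (2 * k + 3))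
    (fun x y h => G1Vertex.level_le_of_adj (Or.inl rfl)
      (Or.inr ⟨rfl, fun h' => ⟨hno x h', hno y h'⟩⟩) (f.map_adj_iff.2 h)) (p 0) v
  have := hconn.nonempty
  have h2 : G.dist (p 0) v ≤ G.diam :=
    SimpleGraph.dist_le_diam (SimpleGraph.connected_iff_ediam_ne_top.1 hconn)
  simp only [hf, hv, spineVertex, G1Vertex.level, Fin.val_zero, if_true,
    show 2 * k + 2 ≠ 1 by omega, if_false] at h1
  omega

theorem le_add_two_of_adj_adj (hconn : G.Connected) {p : SimpleGraph.pathGraph n ↪g G}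
    (hp : ∀ i j : Fin _, (j : ℕ) ≤ i + G.dist (p i) (p j)) {x : V} {i j : Fin n}
    (hi : G.Adj x (p i)) (hj : G.Adj x (p j)) : (j : ℕ) ≤ i + 2 := by
  have h1 := SimpleGraph.dist_eq_one_iff_adj.2 hi.symm
  have h2 := SimpleGraph.dist_eq_one_iff_adj.2 hj
  have h3 := hconn.dist_triangle (u := p i) (v := x) (w := p j)
  have h4 := hp i j
  omega

theorem le_add_three_of_adj (hconn : G.Connected) {p : SimpleGraph.pathGraph n ↪g G}
    (hp : ∀ i j : Fin _, (j : ℕ) ≤ i + G.dist (p i) (p j)) {x y : V} {i j : Fin n}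
    (hi : G.Adj x (p i)) (hj : G.Adj y (p j)) (hxy : G.Adj x y) : (j : ℕ) ≤ i + 3 := by
  have h1 := SimpleGraph.dist_eq_one_iff_adj.2 hi.symm
  have h2 := SimpleGraph.dist_eq_one_iff_adj.2 hj
  have h3 := hconn.dist_triangle (u := p i) (v := x) (w := p j)
  have h5 := hconn.dist_triangle (u := x) (v := y) (w := p j)
  have h6 := SimpleGraph.dist_eq_one_iff_adj.2 hxy
  have h4 := hp i j
  omega

variable [DecidableRel G.Adj]

/-- The neighbors of a vertex on a geodesic lie within three consecutive positions. -/
theorem attachMatrix_shape (hconn : G.Connected) (p : SimpleGraph.pathGraph n ↪g G)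
    (hp : ∀ i j : Fin _, (j : ℕ) ≤ i + G.dist (p i) (p j)) (x : V) :
    attachMatrix G p x = 0 ∨ ∃ (i : ℕ) (α β : ℝ), 1 ≤ i ∧ i ≤ n ∧
      (α = 0 ∨ α = 1 ∧ i + 1 ≤ n) ∧ (β = 0 ∨ β = 1 ∧ i + 2 ≤ n) ∧
      attachMatrix G p x = posVec n i + α • posVec n (i + 1) + β • posVec n (i + 2) := by
  by_cases h : ∃ m, ∃ hm : m < n, G.Adj x (p ⟨m, hm⟩)
  · classical
    right
    obtain ⟨m, ⟨hm, hadj⟩, hmin⟩ : ∃ m, (∃ hm : m < n, G.Adj x (p ⟨m, hm⟩)) ∧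
        ∀ l < m, ¬ ∃ hl : l < n, G.Adj x (p ⟨l, hl⟩) :=
      ⟨Nat.find h, Nat.find_spec h, fun l hl => Nat.find_min h hl⟩
    have hfar : ∀ j, (hj : j < n) → m + 2 < j → ¬ G.Adj x (p ⟨j, hj⟩) := fun j hj hlt hxj => by
      have := le_add_two_of_adj_adj hconn hp hadj hxj
      simp only at this
      omega
    refine ⟨m + 1, if ∃ hm : m + 1 < n, G.Adj x (p ⟨m + 1, hm⟩) then 1 else 0,
      if ∃ hm : m + 2 < n, G.Adj x (p ⟨m + 2, hm⟩) then 1 else 0, by omega, by omega, ?_, ?_, ?_⟩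
    · split_ifs with h1
      · obtain ⟨h1, -⟩ := h1
        exact Or.inr ⟨rfl, by omega⟩
      · exact Or.inl rfl
    · split_ifs with h1
      · obtain ⟨h1, -⟩ := h1
        exact Or.inr ⟨rfl, by omega⟩
      · exact Or.inl rfl
    · ext ⟨a, ha⟩
      simp only [attachMatrix_apply, Pi.add_apply, Pi.smul_apply, posVec_apply, smul_eq_mul]
      obtain h1 | rfl | rfl | rfl | h1 : a < m ∨ a = m ∨ a = m + 1 ∨ a = m + 2 ∨ m + 2 < a := by
        omega
      · have h2 : ¬ G.Adj x (p ⟨a, ha⟩) := fun h2 => hmin a h1 ⟨ha, h2⟩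
        have e0 : a + 1 ≠ m + 1 := by omega
        have e1 : a + 1 ≠ m + 1 + 1 := by omega
        have e2 : a + 1 ≠ m + 1 + 2 := by omega
        rw [if_neg h2, if_neg e0, if_neg e1, if_neg e2]
        ring
      · rw [if_pos hadj]
        simp
      · simp [ha]
      · simp [ha]
      · have e0 : a + 1 ≠ m + 1 := by omega
        have e1 : a + 1 ≠ m + 1 + 1 := by omega
        have e2 : a + 1 ≠ m + 1 + 2 := by omega
        rw [if_neg (hfar a ha h1), if_neg e0, if_neg e1, if_neg e2]
        ring
  · left
    ext a
    rw [attachMatrix_apply, if_neg fun h' => h ⟨a, a.2, h'⟩]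
    rfl

/-- The form of the inverse path matrix on a neighborhood within three consecutive positions. Only
adjacent positions `i, i + 1` with `i` odd interact. -/
theorem shape_form (hn : Even n) {i : ℕ} {α β : ℝ} (h1 : i ≤ n)
    (hβ : β = 0 ∨ β = 1 ∧ i + 2 ≤ n) {c : Fin n → ℝ}
    (hc : c = posVec n i + α • posVec n (i + 1) + β • posVec n (i + 2)) :
    c ⬝ᵥ pathInvMatrix n *ᵥ c = if Odd i then 2 * α else 2 * α * β := by
  have key : c ⬝ᵥ pathInvMatrix n *ᵥ c =
      2 * α * pathInv i (i + 1) + 2 * (α * β) * pathInv (i + 1) (i + 2) := by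
    have z0 : pathInv i i = 0 := pathInv_eq_zero (by grind)
    have z1 : pathInv (i + 1) (i + 1) = 0 := pathInv_eq_zero (by grind)
    have z2 : pathInv (i + 2) (i + 2) = 0 := pathInv_eq_zero (by grind)
    have z3 : pathInv i (i + 2) = 0 := pathInv_eq_zero (by grind)
    have z4 : pathInv (i + 2) i = 0 := pathInv_eq_zero (by grind)
    subst hc
    rcases hβ with rfl | ⟨rfl, hβ⟩
    · simp only [mulVec_add, mulVec_smul, dotProduct_add, add_dotProduct, smul_dotProduct,
        dotProduct_smul, zero_smul, add_zero]
      rw [posVec_dotProduct_posVec hn (by omega) (by omega),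
        posVec_dotProduct_posVec hn (by omega) (by omega),
        posVec_dotProduct_posVec hn (by omega) (by omega),
        posVec_dotProduct_posVec hn (by omega) (by omega), z0, z1, pathInv_comm (i + 1) i]
      simp only [smul_eq_mul]
      ring
    · simp only [mulVec_add, mulVec_smul, dotProduct_add, add_dotProduct, smul_dotProduct,
        dotProduct_smul]
      simp only [posVec_dotProduct_posVec hn (show i ≤ n + 1 by omega),
        posVec_dotProduct_posVec hn (show i + 1 ≤ n + 1 by omega),
        posVec_dotProduct_posVec hn (show i + 2 ≤ n + 1 by omega),
        show i ≤ n + 1 by omega, show i + 1 ≤ n + 1 by omega, show i + 2 ≤ n + 1 by omega,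
        z0, z1, z2, z3, z4, pathInv_comm (i + 1) i, pathInv_comm (i + 2) (i + 1), smul_eq_mul]
      ring
  rw [key]
  split_ifs with ho
  · rw [pathInv_succ ho, pathInv_eq_zero (i := i + 1) (by grind)]
    ring
  · rw [pathInv_succ (i := i + 1) (by grind), pathInv_eq_zero (i := i) (by grind)]
    ring

/-- The diagonal of the Schur complement of a geodesic is nonpositive; its entries are the
negatives of these values. -/
theorem attachMatrix_form_nonneg (hn : Even n) (hconn : G.Connected)
    (p : SimpleGraph.pathGraph n ↪g G)
    (hp : ∀ i j : Fin _, (j : ℕ) ≤ i + G.dist (p i) (p j)) (x : V) :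
    0 ≤ attachMatrix G p x ⬝ᵥ pathInvMatrix n *ᵥ attachMatrix G p x := by
  rcases attachMatrix_shape hconn p hp x with h | ⟨i, α, β, -, h2, hα, hβ, hc⟩
  · rw [h, zero_dotProduct]
  · rw [shape_form hn h2 hβ hc]
    have : 0 ≤ α := by rcases hα with rfl | ⟨rfl, -⟩ <;> norm_num
    have : 0 ≤ β := by rcases hβ with rfl | ⟨rfl, -⟩ <;> norm_num
    split_ifs <;> positivity

theorem attachMatrix_ne_zero (hconn : G.Connected) {p : SimpleGraph.pathGraph (n + 2) ↪g G}
    (hkey : ∀ x y, (if G.Adj x y then 1 else 0)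
      = attachMatrix G p x ⬝ᵥ pathInvMatrix (n + 2) *ᵥ attachMatrix G p y) (x : V) :
    attachMatrix G p x ≠ 0 := by
  intro h
  have : Nontrivial V := ⟨p 0, p 1, fun h => absurd (p.injective h) (by simp)⟩
  obtain ⟨y, hy⟩ := hconn.preconnected.exists_adj_of_nontrivial x
  have := hkey x y
  rw [if_pos hy, h, zero_dotProduct] at this
  exact one_ne_zero this

/-- If the Schur complement of a geodesic vanishes, the neighborhood of any vertex on the geodesic
is that of a vertex of the geodesic, or a single position, or two positions `i, i + 1` with `i`
even. -/
theorem attachMatrix_classification (hconn : G.Connected)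
    {p : SimpleGraph.pathGraph (2 * k + 2) ↪g G}
    (hp : ∀ i j : Fin _, (j : ℕ) ≤ i + G.dist (p i) (p j))
    (hkey : ∀ x y, (if G.Adj x y then 1 else 0)
      = attachMatrix G p x ⬝ᵥ pathInvMatrix (2 * k + 2) *ᵥ attachMatrix G p y) (x : V) :
    (∃ i, (1 ≤ i ∧ i ≤ 2 * k + 2) ∧
      attachMatrix G p x = posVec (2 * k + 2) (i - 1) + posVec (2 * k + 2) (i + 1)) ∨
    (∃ i, (1 ≤ i ∧ i ≤ 2 * k + 2 ∧ i ≠ 2 ∧ i ≠ 2 * k + 1) ∧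
      attachMatrix G p x = posVec (2 * k + 2) i) ∨
    (∃ i, (Even i ∧ 2 ≤ i ∧ i ≤ 2 * k) ∧
      attachMatrix G p x = posVec (2 * k + 2) i + posVec (2 * k + 2) (i + 1)) := by
  have hn : Even (2 * k + 2) := ⟨k + 1, by ring⟩
  rcases attachMatrix_shape hconn p hp x with h | ⟨i, α, β, h1, h2, hα, hβ, hc⟩
  · exact absurd h (attachMatrix_ne_zero hconn hkey x)
  have h0 := hkey x x
  rw [if_neg G.irrefl, shape_form hn h2 hβ hc] at h0
  rcases hα with rfl | ⟨rfl, hα⟩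
  · rcases hβ with rfl | ⟨rfl, hβ⟩
    · rw [zero_smul, zero_smul, add_zero, add_zero] at hc
      -- The single positions `2` and `2k + 1` are the neighborhoods of the ends of the path.
      by_cases hi2 : i = 2
      · subst hi2
        exact Or.inl ⟨1, by omega, by rw [hc, posVec_eq_zero (Or.inl rfl), zero_add]⟩
      by_cases hi3 : i = 2 * k + 1
      · subst hi3
        refine Or.inl ⟨2 * k + 2, by omega, ?_⟩
        rw [hc, posVec_eq_zero (i := 2 * k + 2 + 1) (Or.inr (by omega)), add_zero]
        rfl
      exact Or.inr (Or.inl ⟨i, by omega, hc⟩)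
    · -- The positions `i` and `i + 2` are the neighborhood of the vertex `i + 1` of the path.
      rw [zero_smul, add_zero, one_smul] at hc
      exact Or.inl ⟨i + 1, by omega, hc⟩
  · -- With `α = 1`, the vanishing of the form excludes odd `i` as well as three positions.
    by_cases ho : Odd i
    · rw [if_pos ho] at h0
      norm_num at h0
    · rw [if_neg ho] at h0
      have hβ0 : β = 0 := by linarith
      rw [hβ0, one_smul, zero_smul, add_zero] at hc
      exact Or.inr (Or.inr ⟨i, by grind, hc⟩)

/-- The vertex `x` has a neighborhood on the path as a vertex off the path does, and `m` is one of
its positions: `x` has `m` as its only neighbor on the path, or it has an even position and its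
successor, of which `m` is the even or the odd one. The two end vertices of the path, whose only
positions are `2` and `n - 1`, are not excluded; they impose no constraint. -/
def OffPath (p : SimpleGraph.pathGraph n ↪g G) (x : V) (m : ℕ) : Prop :=
  (1 ≤ m ∧ m ≤ n) ∧ (attachMatrix G p x = posVec n m ∨
    (Even m ∧ m + 1 ≤ n ∧ attachMatrix G p x = posVec n m + posVec n (m + 1)) ∨
    (Odd m ∧ attachMatrix G p x = posVec n (m - 1) + posVec n m))

theorem OffPath.adj {p : SimpleGraph.pathGraph n ↪g G} {x : V} {m : ℕ} (h : OffPath p x m) :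
    G.Adj x (p ⟨m - 1, by have := h.1; omega⟩) := by
  obtain ⟨hm, h⟩ := h
  by_contra hx
  have h1 : attachMatrix G p x ⟨m - 1, by omega⟩ = 0 := if_neg hx
  rcases h with h | ⟨-, -, h⟩ | ⟨-, h⟩ <;> rw [h] at h1 <;>
    simp only [Pi.add_apply, posVec_apply] at h1 <;> grind

/-- For positions `o + 1 < e`, the other pairs of positions of `x` and `y` contribute nothing to
the form. -/
theorem OffPath.form (hn : Even n) {p : SimpleGraph.pathGraph n ↪g G} {x y : V} {o e : ℕ}
    (hx : OffPath p x o) (hy : OffPath p y e) (ho : Odd o) (he : Even e) (hoe : o + 1 < e) :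
    attachMatrix G p x ⬝ᵥ pathInvMatrix n *ᵥ attachMatrix G p y = pathInv o e := by
  have bil : ∀ {i j : ℕ}, i ≤ n + 1 → j ≤ n + 1 →
    posVec n i ⬝ᵥ pathInvMatrix n *ᵥ posVec n j = pathInv i j := posVec_dotProduct_posVec hn
  obtain ⟨hxm, hx⟩ := hx
  obtain ⟨hym, hy⟩ := hy
  have hx' : attachMatrix G p x = posVec n o ∨
      attachMatrix G p x = posVec n (o - 1) + posVec n o := by grind
  have hy' : attachMatrix G p y = posVec n e ∨
      attachMatrix G p y = posVec n e + posVec n (e + 1) := by grind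
  have z1 : pathInv (o - 1) e = 0 := pathInv_eq_zero (by grind)
  have z2 : pathInv o (e + 1) = 0 := pathInv_eq_zero (by grind)
  have z3 : pathInv (o - 1) (e + 1) = 0 := pathInv_eq_zero (by grind)
  rcases hx' with hx' | hx' <;> rcases hy' with hy' | hy' <;>
    simp [hx', hy', mulVec_add, bil, z1, z2, z3, show o ≤ n + 1 by omega,
      show e ≤ n + 1 by omega, show o ≤ n + 2 by omega, show e ≤ n by omega]

/-- If `o + 1 < e`, the form has value `±1` at `x` and `y`, so they are adjacent. As the path is a
geodesic, this leaves `e = o + 3`, where the value is `-1`. -/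
theorem OffPath.le_succ (hn : Even n) (hconn : G.Connected) {p : SimpleGraph.pathGraph n ↪g G}
    (hp : ∀ i j : Fin _, (j : ℕ) ≤ i + G.dist (p i) (p j))
    (hkey : ∀ x y, (if G.Adj x y then 1 else 0)
      = attachMatrix G p x ⬝ᵥ pathInvMatrix n *ᵥ attachMatrix G p y) {x y : V} {o e : ℕ}
    (hx : OffPath p x o) (hy : OffPath p y e) (ho : Odd o) (he : Even e) : e ≤ o + 1 := by
  by_contra hoe
  rw [not_le] at hoe
  have h := hkey x y
  rw [hx.form hn hy ho he hoe] at h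
  by_cases hxy : G.Adj x y
  · have h3 := le_add_three_of_adj hconn hp hx.adj hy.adj hxy
    have := hx.1
    obtain rfl : e = o + 3 := by
      simp only at h3
      grind
    rw [if_pos hxy, pathInv_add_three ho] at h
    norm_num at h
  · rw [if_neg hxy, pathInv_of_lt ho he (by omega)] at h
    exact pow_ne_zero _ (by norm_num) h.symm

/-- By `OffPath.le_succ`, some `t` separates the even positions from the odd ones. -/
theorem exists_threshold (hconn : G.Connected) {p : SimpleGraph.pathGraph (2 * k + 2) ↪g G}
    (hp : ∀ i j : Fin _, (j : ℕ) ≤ i + G.dist (p i) (p j))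
    (hkey : ∀ x y, (if G.Adj x y then 1 else 0)
      = attachMatrix G p x ⬝ᵥ pathInvMatrix (2 * k + 2) *ᵥ attachMatrix G p y) :
    ∃ t ≤ k, (∀ y e, OffPath p y e → Even e → e ≤ 2 * t + 2) ∧
      ∀ x o, OffPath p x o → Odd o → 2 * t + 1 ≤ o := by
  classical
  have hn : Even (2 * k + 2) := ⟨k + 1, by ring⟩
  have hex : ∃ t, ∀ y e, OffPath p y e → Even e → e ≤ 2 * t + 2 := ⟨k, fun y e h _ => h.1.2⟩
  refine ⟨Nat.find hex, Nat.find_min' hex fun y e h _ => h.1.2, Nat.find_spec hex,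
    fun x o hx ho => ?_⟩
  -- By minimality of `t`, some vertex has an even position greater than `2 * t`.
  by_contra hlt
  obtain ⟨s, hs⟩ : ∃ s, Nat.find hex = s + 1 := ⟨Nat.find hex - 1, by have := hx.1; omega⟩
  have := Nat.find_min hex (m := s) (by omega)
  push Not at this
  obtain ⟨y, e, hy, he, hlt'⟩ := this
  have := OffPath.le_succ hn hconn hp hkey hx hy ho he
  grind

theorem exists_vec_eq (hconn : G.Connected) {p : SimpleGraph.pathGraph (2 * k + 2) ↪g G}
    (hp : ∀ i j : Fin _, (j : ℕ) ≤ i + G.dist (p i) (p j))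
    (hkey : ∀ x y, (if G.Adj x y then 1 else 0)
      = attachMatrix G p x ⬝ᵥ pathInvMatrix (2 * k + 2) *ᵥ attachMatrix G p y) :
    ∃ t ≤ k, ∀ x, ∃ q : G1Vertex k t, q.vec = attachMatrix G p x := by
  obtain ⟨t, ht, hE, hO⟩ := exists_threshold hconn hp hkey
  refine ⟨t, ht, fun x => ?_⟩
  rcases attachMatrix_classification hconn hp hkey x with ⟨i, hi, hc⟩ | ⟨i, hi, hc⟩ | ⟨i, hi, hc⟩
  · exact ⟨.spine i hi, hc.symm⟩
  · have hoff : OffPath p x i := ⟨by omega, Or.inl hc⟩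
    have h1 := hE x i hoff
    have h2 := hO x i hoff
    exact ⟨.single i (by grind), hc.symm⟩
  · have h1 := hE x i ⟨by omega, Or.inr (Or.inl ⟨hi.1, by omega, hc⟩)⟩ hi.1
    have h2 := hO x (i + 1) ⟨by omega, Or.inr (Or.inr ⟨hi.1.add_one, hc⟩)⟩ hi.1.add_one
    exact ⟨.double i (by grind), hc.symm⟩

/-- Sending each vertex to the vertex of `G₁(k, t)` with the same neighbors on the path is an
embedding: adjacency is given by the same form on both sides, and vertices with the same neighbors
on the path are twins. -/
theorem exists_embedding (hconn : G.Connected) (hred : IsReduced G)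
    {p : SimpleGraph.pathGraph (2 * k + 2) ↪g G}
    (hp : ∀ i j : Fin _, (j : ℕ) ≤ i + G.dist (p i) (p j))
    (hkey : ∀ x y, (if G.Adj x y then 1 else 0)
      = attachMatrix G p x ⬝ᵥ pathInvMatrix (2 * k + 2) *ᵥ attachMatrix G p y) :
    ∃ t ≤ k, ∃ f : G ↪g G1 k t, ∀ i, f (p i) = spineVertex k t i := by
  classical
  obtain ⟨t, ht, h⟩ := exists_vec_eq hconn hp hkey
  choose f hf using h
  refine ⟨t, ht, ⟨⟨f, fun x y hxy => hred x y ?_⟩, fun {x y} => ?_⟩, fun i => ?_⟩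
  · have hC : attachMatrix G p x = attachMatrix G p y := by rw [← hf, ← hf, hxy]
    ext z
    have h1 := hkey x z
    rw [hC, ← hkey y z] at h1
    simp only [SimpleGraph.mem_neighborSet]
    by_cases hx : G.Adj x z <;> by_cases hy : G.Adj y z <;> simp_all
  · have h1 := hkey x y
    rw [← hf, ← hf, ← G1_adj_eq_form ht] at h1
    change (G1 k t).Adj (f x) (f y) ↔ G.Adj x y
    by_cases hx : G.Adj x y <;> by_cases hy : (G1 k t).Adj (f x) (f y) <;> simp_all
  · refine G1Vertex.vec_injective ht ?_
    change (f (p i)).vec = (spineVertex k t i).vec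
    rw [hf, spineVertex, vec_spine_eq]
    ext j
    rw [attachMatrix_embedding]
    exact (congrFun (congrFun (pathMatrix_transpose _) i) j).symm

end Necessity

end NegInertiaDiam

theorem theorem2p9 {V : Type*} [Fintype V] [DecidableEq V] (G : SimpleGraph V)
    [DecidableRel G.Adj] (hconn : G.Connected) (hred : NegInertiaDiam.IsReduced G)
    (k : ℕ) (hk : 1 ≤ k) :
    (G.diam = 2 * k + 1 ∧ NegInertiaDiam.negInertia G = k + 1) ↔
      ∃ t : ℕ, t ≤ k ∧
        ∃ (p : SimpleGraph.pathGraph (2 * k + 2) ↪g G) (f : G ↪g NegInertiaDiam.G1 k t),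
          (∀ i, f (p i) = NegInertiaDiam.spineVertex k t i) ∧
          (∀ v h, f v = .single 1 h → ∃ w h', f w = .double 2 h') ∧
          (∀ v h, f v = .single (2 * k + 2) h → ∃ w h', f w = .double (2 * k) h') := by
  constructor
  · rintro ⟨hdiam, hneg⟩
    have := hconn.nonempty
    obtain ⟨u, v, huv⟩ := G.exists_dist_eq_diam
    obtain ⟨p, hp⟩ := NegInertiaDiam.exists_geodesic hconn (huv.trans hdiam)
    have hn : Even (2 * k + 2) := ⟨k + 1, by ring⟩
    have hA := NegInertiaDiam.adjMatrix_factorization p hneg.le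
      (NegInertiaDiam.attachMatrix_form_nonneg hn hconn p hp)
    obtain ⟨t, ht, f, hf⟩ := NegInertiaDiam.exists_embedding hconn hred hp fun x y => by
      rw [← NegInertiaDiam.factorization_apply, ← hA, SimpleGraph.adjMatrix_apply]
    exact ⟨t, ht, p, f, hf, fun v h hv => NegInertiaDiam.exists_double_left hconn hf hdiam hv,
      fun v h hv => NegInertiaDiam.exists_double_right hconn hf hdiam hv⟩
  · rintro ⟨t, ht, p, f, hf, hl, hr⟩
    exact ⟨NegInertiaDiam.diam_eq_of_embedding hk ht hconn hf hl hr,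
      NegInertiaDiam.negInertia_eq_of_embedding ht hf⟩
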